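/- Let $A$ be a C*-algebra. A closed two-sided ideal $J$ of $A$ is regarded as a Hilbert C*-module over $A$, a submodule of the Hilbert $A$-module $A$. The *compact endomorphisms* of a Hilbert $A$-module $Y$ are the elements of the operator-norm closed linear span of the rank one maps $\theta_{x,y}$, $x,y\in Y$, where $\theta_{x,y}(z)$ is $x$ multiplied by the scalar $\langle y,z\rangle\in A$. For closed two-sided ideals $I,J$ of $A$ write $I\subset\subset J$ if $I\subseteq J$ and there is a compact self-adjoint endomorphism $b$ of the Hilbert $A$-module $J$ such that $b(x)=x$ for all $x\in I$. Let $A\otimes A$ be the spatial (minimal) tensor product, that is, the norm closure of the algebraic tensor product $A\odot A$ in the bounded operators on $H\otimes K$, where $A$ is represented faithfully on Hilbert spaces $H$ and $K$. More generally, $A\otimes A$ may be the completion of $A\odot A$ in any C*-norm, for example the maximal one. For closed two-sided ideals $I,J$ of $A$, let $I\otimes J$ be the closure in $A\otimes A$ of the linear span of all $x\otimes y$ with $x\in I$, $y\in J$. It is a closed two-sided ideal of $A\otimes A$, and as a Hilbert $A\otimes A$-module it is the external tensor product of the Hilbert modules $I$ and $J$. **Corollary 4.2.** Let $I_1,I_2,J_1,J_2$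 be closed two-sided ideals of $A$ with $I_1\subset\subset J_1$ and $I_2\subset\subset J_2$. Then $$I_1\otimes I_2\subset\subset J_1\otimes J_2 .$$ Moreover, if $I_1$ and $I_2$ are countably generated as Hilbert C*-modules, then so is $I_1\otimes I_2$, and likewise for $J_1$, $J_2$ and $J_1\otimes J_2$. -/

import Mathlib

open scoped TensorProduct

noncomputable section

namespace HilbertIdeal

/-! ### Hilbert C*-modules: compact endomorphisms, compact containment -/

section HilbertModule

variable (A : Type*) {Y : Type*} [NonUnitalCStarAlgebra A] [PartialOrder A] [StarOrderedRing A]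
  [NormedAddCommGroup Y] [NormedSpace ℂ Y] [SMul A Y] [CStarModule A Y] [CompleteSpace Y]

/-- The rank one endomorphisms `θ_{x,y}` of the Hilbert `A`-module `Y`: `θ_{x,y} z` is `x` multiplied
by the scalar `⟪y, z⟫ ∈ A`.  (In Mathlib the scalars of a Hilbert C*-module are written on the left
and `⟪y, a • z⟫ = a * ⟪y, z⟫`.) -/
def rankOneEndomorphisms : Set (Y →L[ℂ] Y) :=
  {f | ∃ x y : Y, ∀ z : Y, f z = (inner A y z : A) • x}

/-- The compact endomorphisms of the Hilbert `A`-module `Y`: the operator norm closure of the linear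
span of the rank one endomorphisms. -/
def compactEndomorphisms : Submodule ℂ (Y →L[ℂ] Y) :=
  (Submodule.span ℂ (rankOneEndomorphisms A)).topologicalClosure

/-- A self-adjoint endomorphism of the Hilbert `A`-module `Y`. -/
def IsSelfAdjointEndomorphism (b : Y →L[ℂ] Y) : Prop :=
  ∀ x y : Y, (inner A (b x) y : A) = inner A x (b y)

/-- A submodule `X` of the Hilbert `A`-module `Y` is compactly contained in `Y` if there is a compact
self-adjoint endomorphism of `Y` which acts as the identity on `X`. -/
def CompactlyContainedSubmodule (X : Submodule ℂ Y) : Prop :=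
  ∃ b : Y →L[ℂ] Y, b ∈ compactEndomorphisms A ∧ IsSelfAdjointEndomorphism A b ∧ ∀ x ∈ X, b x = x

variable (Y) in
/-- The Hilbert `A`-module `Y` is countably generated: for some countable set `S` the linear span of
the elements `a • s` with `a ∈ A` and `s ∈ S` is dense. -/
def CountablyGeneratedModule : Prop :=
  ∃ S : Set Y, S.Countable ∧
    (Submodule.span ℂ {z : Y | ∃ a : A, ∃ s ∈ S, z = a • s}).topologicalClosure = ⊤

end HilbertModule

/-! ### Closed two-sided ideals as Hilbert C*-modules -/

/-- A closed two-sided ideal of a C*-algebra. -/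
structure ClosedIdeal (A : Type*) [NonUnitalCStarAlgebra A] extends Submodule ℂ A where
  mul_mem_left' : ∀ (a : A) {x : A}, x ∈ carrier → a * x ∈ carrier
  mul_mem_right' : ∀ (a : A) {x : A}, x ∈ carrier → x * a ∈ carrier
  isClosed' : IsClosed carrier

namespace ClosedIdeal

section

variable {A : Type*} [NonUnitalCStarAlgebra A] (I : ClosedIdeal A)

instance : CompleteSpace I.toSubmodule :=
  IsClosed.completeSpace_coe (hs := I.isClosed')

/-- The action of `A` on a closed ideal by multiplication. -/
instance : SMul A I.toSubmodule := ⟨fun a x => ⟨a * x.1, I.mul_mem_left' a x.2⟩⟩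

/-- A closed ideal of `A` is a Hilbert C*-module over `A`, as a submodule of the Hilbert C*-module
`A`: the inner product is `⟪x, y⟫ = y * star x`. -/
instance [PartialOrder A] [StarOrderedRing A] : CStarModule A I.toSubmodule where
  inner x y := y.1 * star x.1
  inner_add_right {x y z} := add_mul y.1 z.1 (star x.1)
  inner_self_nonneg {x} := mul_star_self_nonneg x.1
  inner_self {x} := (CStarRing.mul_star_self_eq_zero_iff x.1).trans ZeroMemClass.coe_eq_zero
  inner_op_smul_right {a x y} := mul_assoc a y.1 (star x.1)
  inner_smul_right_complex {z x y} := smul_mul_assoc z y.1 (star x.1)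
  star_inner x y := by simp
  norm_eq_sqrt_norm_inner_self x := by
    rw [CStarRing.norm_self_mul_star, Real.sqrt_mul_self (norm_nonneg _)]
    rfl

end

variable {A : Type*} [NonUnitalCStarAlgebra A]

/-- The closed ideal `I` is compactly contained in the closed ideal `J`, written `I ⊂⊂ J`: `I` is
contained in `J`, and the Hilbert C*-module `I` is compactly contained in the Hilbert C*-module `J`.
(The partial order used is the usual order of the C*-algebra `A`.) -/
def CompactlyContained (I J : ClosedIdeal A) : Prop :=
  letI := CStarAlgebra.spectralOrder A
  letI := CStarAlgebra.spectralOrderedRing A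
  I.toSubmodule ≤ J.toSubmodule ∧
    CompactlyContainedSubmodule A (Y := J.toSubmodule) (I.toSubmodule.comap J.toSubmodule.subtype)

/-- The closed ideal `I` is countably generated as a Hilbert C*-module. -/
def CountablyGenerated (I : ClosedIdeal A) : Prop :=
  letI := CStarAlgebra.spectralOrder A
  letI := CStarAlgebra.spectralOrderedRing A
  CountablyGeneratedModule A I.toSubmodule

end ClosedIdeal

infix:50 " ⊂⊂ " => ClosedIdeal.CompactlyContained

/-! ### Tensor products of C*-algebras -/

/-- A C*-tensor product of the C*-algebras `A` and `B`: a C*-algebra `T` which is a completion of the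
algebraic tensor product `A ⊗ B` (for some C*-norm on it). -/
structure CStarTensorProduct (A B T : Type*) [NonUnitalCStarAlgebra A] [NonUnitalCStarAlgebra B]
    [NonUnitalCStarAlgebra T] where
  /-- The inclusion of the algebraic tensor product. -/
  hom : A ⊗[ℂ] B →⋆ₙₐ[ℂ] T
  injective : Function.Injective hom
  denseRange : DenseRange hom

namespace CStarTensorProduct

variable {A B T : Type*} [NonUnitalCStarAlgebra A] [NonUnitalCStarAlgebra B]
    [NonUnitalCStarAlgebra T] (τ : CStarTensorProduct A B T)

/-- The linear span in `T` of the elementary tensors `x ⊗ y` with `x ∈ I` and `y ∈ J`. -/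
def algIdeal (I : ClosedIdeal A) (J : ClosedIdeal B) : Submodule ℂ T :=
  Submodule.span ℂ {t : T | ∃ x ∈ I.toSubmodule, ∃ y ∈ J.toSubmodule, t = τ.hom (x ⊗ₜ[ℂ] y)}

theorem mul_mem_left_aux (I : ClosedIdeal A) (J : ClosedIdeal B) (a t : T)
    (ht : t ∈ (τ.algIdeal I J).topologicalClosure) :
    a * t ∈ (τ.algIdeal I J).topologicalClosure := by
  have hc : IsClosed ((τ.algIdeal I J).topologicalClosure : Set T) :=
    Submodule.isClosed_topologicalClosure _
  refine τ.denseRange.induction_on (p := fun a => a * t ∈ (τ.algIdeal I J).topologicalClosure) a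
    (hc.preimage (by fun_prop)) fun s => ?_
  let F : T → T := fun t => τ.hom s * t
  have : Set.MapsTo F (τ.algIdeal I J : Set T) (τ.algIdeal I J) := by
    intro t ht
    change τ.hom s * t ∈ τ.algIdeal I J
    induction ht using Submodule.span_induction with
    | mem t ht =>
      obtain ⟨x, hx, y, hy, rfl⟩ := ht
      simp only [← map_mul]
      induction s using TensorProduct.induction_on with
      | zero => simp
      | tmul a b =>
        rw [Algebra.TensorProduct.tmul_mul_tmul]
        exact Submodule.subset_span
          ⟨_, I.mul_mem_left' a hx, _, J.mul_mem_left' b hy, rfl⟩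
      | add u v hu hv =>
        rw [add_mul, map_add]
        exact add_mem hu hv
    | zero => simp
    | add u v _ _ hu hv => simpa only [mul_add] using add_mem hu hv
    | smul c u _ hu =>
      simpa only [mul_smul_comm] using (τ.algIdeal I J).smul_mem c hu
  exact map_mem_closure (f := F) (by fun_prop) ht this

theorem mul_mem_right_aux (I : ClosedIdeal A) (J : ClosedIdeal B) (a t : T)
    (ht : t ∈ (τ.algIdeal I J).topologicalClosure) :
    t * a ∈ (τ.algIdeal I J).topologicalClosure := by
  have hc : IsClosed ((τ.algIdeal I J).topologicalClosure : Set T) :=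
    Submodule.isClosed_topologicalClosure _
  refine τ.denseRange.induction_on (p := fun a => t * a ∈ (τ.algIdeal I J).topologicalClosure) a
    (hc.preimage (by fun_prop)) fun s => ?_
  let F : T → T := fun t => t * τ.hom s
  have : Set.MapsTo F (τ.algIdeal I J : Set T) (τ.algIdeal I J) := by
    intro t ht
    change t * τ.hom s ∈ τ.algIdeal I J
    induction ht using Submodule.span_induction with
    | mem t ht =>
      obtain ⟨x, hx, y, hy, rfl⟩ := ht
      simp only [← map_mul]
      induction s using TensorProduct.induction_on with
      | zero => simp
      | tmul a b =>
        rw [Algebra.TensorProduct.tmul_mul_tmul]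
        exact Submodule.subset_span
          ⟨_, I.mul_mem_right' a hx, _, J.mul_mem_right' b hy, rfl⟩
      | add u v hu hv =>
        rw [mul_add, map_add]
        exact add_mem hu hv
    | zero => simp
    | add u v _ _ hu hv => simpa only [add_mul] using add_mem hu hv
    | smul c u _ hu =>
      simpa only [smul_mul_assoc] using (τ.algIdeal I J).smul_mem c hu
  exact map_mem_closure (f := F) (by fun_prop) ht this

/-- The tensor product `I ⊗ J` of two closed ideals: the closure of the algebraic tensor product of
`I` and `J` in the C*-tensor product `T` of `A` and `B`, a closed ideal of `T`. -/
def ideal (I : ClosedIdeal A) (J : ClosedIdeal B) : ClosedIdeal T where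
  toSubmodule := (τ.algIdeal I J).topologicalClosure
  mul_mem_left' a _ hx := τ.mul_mem_left_aux I J a _ hx
  mul_mem_right' a _ hx := τ.mul_mem_right_aux I J a _ hx
  isClosed' := Submodule.isClosed_topologicalClosure _

/-- The elementary tensor `x ⊗ y ∈ I ⊗ J` of `x ∈ I` and `y ∈ J`. -/
def tmul {I : ClosedIdeal A} {J : ClosedIdeal B} (x : I.toSubmodule) (y : J.toSubmodule) :
    (τ.ideal I J).toSubmodule :=
  ⟨τ.hom (x.1 ⊗ₜ[ℂ] y.1),
    Submodule.le_topologicalClosure _ (Submodule.subset_span ⟨x.1, x.2, y.1, y.2, rfl⟩)⟩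

/-- The Hilbert `T`-module `I ⊗ J` is the external tensor product of the Hilbert modules `I` and `J`:
its inner product is determined by `⟪x₁ ⊗ y₁, x₂ ⊗ y₂⟫ = ⟪x₁, x₂⟫ ⊗ ⟪y₁, y₂⟫`. -/
theorem inner_tmul [PartialOrder A] [StarOrderedRing A] [PartialOrder B] [StarOrderedRing B]
    [PartialOrder T] [StarOrderedRing T] {I : ClosedIdeal A} {J : ClosedIdeal B}
    (x₁ x₂ : I.toSubmodule) (y₁ y₂ : J.toSubmodule) :
    (inner T (τ.tmul x₁ y₁) (τ.tmul x₂ y₂) : T) =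
      τ.hom ((inner A x₁ x₂ : A) ⊗ₜ[ℂ] (inner B y₁ y₂ : B)) := by
  change τ.hom (x₂.1 ⊗ₜ[ℂ] y₂.1) * star (τ.hom (x₁.1 ⊗ₜ[ℂ] y₁.1)) =
    τ.hom ((x₂.1 * star x₁.1) ⊗ₜ[ℂ] (y₂.1 * star y₁.1))
  rw [← map_star, ← map_mul, TensorProduct.star_tmul, Algebra.TensorProduct.tmul_mul_tmul]

end CStarTensorProduct

/-! ### The spatial (minimal) tensor product -/

section Spatial

set_option linter.unusedSectionVars false

variable {A B H K : Type*} [NonUnitalCStarAlgebra A] [NonUnitalCStarAlgebra B]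
  [NormedAddCommGroup H] [InnerProductSpace ℂ H] [CompleteSpace H]
  [NormedAddCommGroup K] [InnerProductSpace ℂ K] [CompleteSpace K]

variable (H K) in
/-- The Hilbert space tensor product of `H` and `K`: the completion of their algebraic tensor product
in the norm of the inner product `⟪x ⊗ y, x' ⊗ y'⟫ = ⟪x, x'⟫ ⟪y, y'⟫`. -/
def HilbertTensor : Type _ := UniformSpace.Completion (H ⊗[ℂ] K)

instance : NormedAddCommGroup (HilbertTensor H K) :=
  inferInstanceAs (NormedAddCommGroup (UniformSpace.Completion (H ⊗[ℂ] K)))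

instance : InnerProductSpace ℂ (HilbertTensor H K) :=
  inferInstanceAs (InnerProductSpace ℂ (UniformSpace.Completion (H ⊗[ℂ] K)))

instance : CompleteSpace (HilbertTensor H K) :=
  inferInstanceAs (CompleteSpace (UniformSpace.Completion (H ⊗[ℂ] K)))

variable (H K) in
/-- The inclusion of the algebraic tensor product into the Hilbert space tensor product. -/
def toHilbertTensor : H ⊗[ℂ] K →ₗᵢ[ℂ] HilbertTensor H K :=
  UniformSpace.Completion.toComplₗᵢ

/-- The operator `a ⊗ b` on the Hilbert space tensor product of `H` and `K`, with
`(a ⊗ b) (x ⊗ y) = a x ⊗ b y`. -/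
def opTensor (a : H →L[ℂ] H) (b : K →L[ℂ] K) : HilbertTensor H K →L[ℂ] HilbertTensor H K :=
  ContinuousLinearMap.completion (TensorProduct.mapL a b)

theorem denseRange_toHilbertTensor : DenseRange (toHilbertTensor H K) :=
  UniformSpace.Completion.denseRange_coe

theorem opTensor_coe (a : H →L[ℂ] H) (b : K →L[ℂ] K) (z : H ⊗[ℂ] K) :
    opTensor a b (toHilbertTensor H K z) = toHilbertTensor H K (TensorProduct.mapL a b z) :=
  ContinuousLinearMap.completion_apply_coe (TensorProduct.mapL a b) z

theorem op_ext {S T : HilbertTensor H K →L[ℂ] HilbertTensor H K}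
    (h : ∀ x y, S (toHilbertTensor H K (x ⊗ₜ[ℂ] y)) = T (toHilbertTensor H K (x ⊗ₜ[ℂ] y))) :
    S = T := by
  ext z
  refine denseRange_toHilbertTensor.induction_on z (isClosed_eq S.continuous T.continuous) fun z => ?_
  induction z using TensorProduct.induction_on with
  | zero => simp
  | tmul x y => exact h x y
  | add u v hu hv => simp [hu, hv]

theorem opTensor_mul (a a' : H →L[ℂ] H) (b b' : K →L[ℂ] K) :
    opTensor (a * a') (b * b') = opTensor a b * opTensor a' b' :=
  op_ext fun x y => by simp [opTensor_coe]

theorem star_opTensor (a : H →L[ℂ] H) (b : K →L[ℂ] K) :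
    star (opTensor a b) = opTensor (star a) (star b) := by
  rw [ContinuousLinearMap.star_eq_adjoint, eq_comm, ContinuousLinearMap.eq_adjoint_iff]
  intro u v
  refine denseRange_toHilbertTensor.induction_on₂
    (p := fun u v => inner ℂ (opTensor (star a) (star b) u) v = inner ℂ u (opTensor a b v))
    (isClosed_eq (by fun_prop) (by fun_prop)) (fun u v => ?_) u v
  simp only [opTensor_coe, LinearIsometry.inner_map_map]
  induction u using TensorProduct.induction_on with
  | zero => simp
  | add u u' hu hu' => rw [map_add, inner_add_left, inner_add_left, hu, hu']
  | tmul x y =>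
    induction v using TensorProduct.induction_on with
    | zero => simp
    | add v v' hv hv' => rw [map_add, inner_add_right, inner_add_right, hv, hv']
    | tmul x' y' =>
      simp [ContinuousLinearMap.star_eq_adjoint, ContinuousLinearMap.adjoint_inner_left]

/-- For representations `π` of `A` on `H` and `ρ` of `B` on `K`, the representation `π ⊗ ρ` of the
algebraic tensor product `A ⊗ B` on the Hilbert space tensor product, `a ⊗ b ↦ π a ⊗ ρ b`. -/
def tensorRep (π : A →⋆ₙₐ[ℂ] (H →L[ℂ] H)) (ρ : B →⋆ₙₐ[ℂ] (K →L[ℂ] K)) :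
    A ⊗[ℂ] B →⋆ₙₐ[ℂ] (HilbertTensor H K →L[ℂ] HilbertTensor H K) :=
  let f : A ⊗[ℂ] B →ₗ[ℂ] (HilbertTensor H K →L[ℂ] HilbertTensor H K) :=
    TensorProduct.lift (LinearMap.mk₂ ℂ (fun a b => opTensor (π a) (ρ b))
      (fun a a' b => op_ext fun x y => by simp [opTensor_coe, TensorProduct.add_tmul])
      (fun c a b => op_ext fun x y => by
        simp [opTensor_coe, ← TensorProduct.smul_tmul', - TensorProduct.tmul_smul])
      (fun a b b' => op_ext fun x y => by simp [opTensor_coe, TensorProduct.tmul_add])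
      (fun c a b => op_ext fun x y => by simp [opTensor_coe]))
  { f with
    map_zero' := f.map_zero
    map_mul' := by
      intro s t
      change f (s * t) = f s * f t
      induction s using TensorProduct.induction_on with
      | zero => simp
      | add u v hu hv => rw [add_mul, map_add, map_add, hu, hv, add_mul]
      | tmul a b =>
        induction t using TensorProduct.induction_on with
        | zero => simp
        | add u v hu hv => rw [mul_add, map_add, map_add, hu, hv, mul_add]
        | tmul a' b' => simp [f, opTensor_mul]
    map_star' := by
      intro t
      change f (star t) = star (f t)
      induction t using TensorProduct.induction_on with
      | zero => simp
      | add u v hu hv => rw [star_add, map_add, map_add, hu, hv, star_add]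
      | tmul a b => simp [f, star_opTensor, map_star] }

@[simp] theorem tensorRep_tmul (π : A →⋆ₙₐ[ℂ] (H →L[ℂ] H)) (ρ : B →⋆ₙₐ[ℂ] (K →L[ℂ] K)) (a : A)
    (b : B) : tensorRep π ρ (a ⊗ₜ[ℂ] b) = opTensor (π a) (ρ b) :=
  rfl

theorem tensorRep_injective (π : A →⋆ₙₐ[ℂ] (H →L[ℂ] H)) (ρ : B →⋆ₙₐ[ℂ] (K →L[ℂ] K))
    (hπ : Function.Injective π) (hρ : Function.Injective ρ) :
    Function.Injective (tensorRep π ρ) := by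
  classical
  rw [injective_iff_map_eq_zero]
  intro t ht
  -- the functionals `a ↦ ⟪x', π a x⟫` separate the points of `A`
  let φ : H → H → A →ₗ[ℂ] ℂ := fun x' x =>
    { toFun := fun a => inner ℂ x' (π a x)
      map_add' := fun a b => by simp
      map_smul' := fun c a => by simp }
  let G : H → H ⊗[ℂ] K →ₗ[ℂ] K := fun x' =>
    (TensorProduct.lid ℂ K).toLinearMap ∘ₗ
      TensorProduct.map (innerSL ℂ x').toLinearMap LinearMap.id
  let Φ : H → H → A ⊗[ℂ] B →ₗ[ℂ] B := fun x' x =>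
    (TensorProduct.lid ℂ B).toLinearMap ∘ₗ TensorProduct.map (φ x' x) LinearMap.id
  have key : ∀ (x' x : H) (y : K) (s : A ⊗[ℂ] B), ∃ z : H ⊗[ℂ] K,
      tensorRep π ρ s (toHilbertTensor H K (x ⊗ₜ[ℂ] y)) = toHilbertTensor H K z ∧
      G x' z = ρ (Φ x' x s) y := by
    intro x' x y s
    induction s using TensorProduct.induction_on with
    | zero => exact ⟨0, by simp⟩
    | tmul a b =>
      exact ⟨π a x ⊗ₜ[ℂ] ρ b y, by simp [opTensor_coe], by simp [G, Φ, φ]⟩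
    | add u v hu hv =>
      obtain ⟨z, h1, h2⟩ := hu
      obtain ⟨w, h3, h4⟩ := hv
      refine ⟨z + w, ?_, ?_⟩
      · rw [map_add, add_apply, h1, h3, map_add]
      · rw [map_add, map_add, map_add, add_apply, h2, h4]
  have h0 : ∀ x' x, Φ x' x t = 0 := by
    intro x' x
    refine (injective_iff_map_eq_zero ρ).1 hρ _ (ContinuousLinearMap.ext fun y => ?_)
    obtain ⟨z, h1, h2⟩ := key x' x y t
    rw [ht] at h1
    have hz : z = 0 := (toHilbertTensor H K).injective (by simpa using h1.symm)
    rw [← h2, hz, map_zero, zero_apply]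
  let 𝒞 := Module.Basis.ofVectorSpace ℂ B
  have hrepr : ∀ (x' x : H) (s : A ⊗[ℂ] B) (i),
      𝒞.repr (Φ x' x s) i = φ x' x (TensorProduct.equivFinsuppOfBasisRight 𝒞 s i) := by
    intro x' x s i
    induction s using TensorProduct.induction_on with
    | zero => simp
    | tmul a b => simp [Φ, mul_comm]
    | add u v hu hv => simp only [map_add, Finsupp.add_apply, hu, hv]
  apply (TensorProduct.equivFinsuppOfBasisRight (M := A) 𝒞).injective
  rw [map_zero]
  ext i
  refine hπ (ContinuousLinearMap.ext fun x => ext_inner_left ℂ fun x' => ?_)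
  have := hrepr x' x t i
  rw [h0] at this
  simpa [φ] using this.symm

/-- The underlying algebra of the spatial tensor product of `A` and `B`, formed in the
representations `π` and `ρ`: the norm closure of the image of the algebraic tensor product in the
bounded operators on the Hilbert space tensor product. -/
def spatialAlgebra (π : A →⋆ₙₐ[ℂ] (H →L[ℂ] H)) (ρ : B →⋆ₙₐ[ℂ] (K →L[ℂ] K)) :
    NonUnitalStarSubalgebra ℂ (HilbertTensor H K →L[ℂ] HilbertTensor H K) :=
  (NonUnitalStarAlgHom.range (tensorRep π ρ)).topologicalClosure

instance (π : A →⋆ₙₐ[ℂ] (H →L[ℂ] H)) (ρ : B →⋆ₙₐ[ℂ] (K →L[ℂ] K)) :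
    NonUnitalCStarAlgebra (spatialAlgebra π ρ) :=
  NonUnitalStarSubalgebra.nonUnitalCStarAlgebra _
    (h_closed := NonUnitalStarSubalgebra.isClosed_topologicalClosure
      (NonUnitalStarAlgHom.range (tensorRep π ρ)))

theorem tensorRep_mem (π : A →⋆ₙₐ[ℂ] (H →L[ℂ] H)) (ρ : B →⋆ₙₐ[ℂ] (K →L[ℂ] K)) (t : A ⊗[ℂ] B) :
    tensorRep π ρ t ∈ spatialAlgebra π ρ :=
  NonUnitalStarSubalgebra.le_topologicalClosure _ ⟨t, rfl⟩

/-- The spatial (minimal) tensor product of the C*-algebras `A` and `B`, formed in the faithful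
representations `π` and `ρ`. -/
def spatialTensorProduct (π : A →⋆ₙₐ[ℂ] (H →L[ℂ] H)) (ρ : B →⋆ₙₐ[ℂ] (K →L[ℂ] K))
    (hπ : Function.Injective π) (hρ : Function.Injective ρ) :
    CStarTensorProduct A B (spatialAlgebra π ρ) where
  hom :=
    { toFun := fun t => ⟨tensorRep π ρ t, tensorRep_mem π ρ t⟩
      map_smul' := fun c t => Subtype.ext (map_smul (tensorRep π ρ) c t)
      map_zero' := Subtype.ext (map_zero (tensorRep π ρ))
      map_add' := fun s t => Subtype.ext (map_add (tensorRep π ρ) s t)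
      map_mul' := fun s t => Subtype.ext (map_mul (tensorRep π ρ) s t)
      map_star' := fun t => Subtype.ext (map_star (tensorRep π ρ) t) }
  injective s t h := tensorRep_injective π ρ hπ hρ (congrArg Subtype.val h)
  denseRange := by
    intro z
    rw [Topology.IsInducing.subtypeVal.closure_eq_preimage_closure_image, ← Set.range_comp]
    exact z.2

end Spatial

end HilbertIdeal

end

open scoped TensorProduct

/-! For `x, y, z` in a closed ideal `J` one has `θ_{x,y} z = z * star y * x`, so rank one maps are
right multiplications by elements `star y * x`. On the closed span of such elements (`coefficients`)
right multiplication is isometric, hence the compact endomorphisms of `J` are exactly the right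
multiplications by coefficients (`compactEndomorphisms_eq`). Thus `I ⊂⊂ J` means: `I ≤ J` and some
self-adjoint coefficient `c` of `J` satisfies `x * c = x` on `I` (`compactlyContained_iff`). If `c`
and `d` witness the two containments, `c ⊗ d` witnesses the one for the tensor products. That it is
again a coefficient, and that products of generating sets generate, holds on elementary tensors and
passes to closures by separate continuity of `(a, b) ↦ a ⊗ b`. This continuity follows from
positivity alone, so any C*-norm is allowed. -/

namespace HilbertIdeal

/-! ### Compact endomorphisms of a closed ideal as right multiplications -/

namespace ClosedIdeal

variable {A : Type*} [NonUnitalCStarAlgebra A] (J : ClosedIdeal A)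

/-- Right multiplication by the elements of `A` on a closed ideal `J`. -/
noncomputable def mulRight : A →L[ℂ] (J.toSubmodule →L[ℂ] J.toSubmodule) :=
  LinearMap.mkContinuous₂
    (LinearMap.mk₂ ℂ (fun c (x : J.toSubmodule) => ⟨x.1 * c, J.mul_mem_right' c x.2⟩)
      (fun c c' x => Subtype.ext (mul_add x.1 c c'))
      (fun r c x => Subtype.ext (mul_smul_comm r x.1 c))
      (fun c x y => Subtype.ext (add_mul x.1 y.1 c))
      (fun r c x => Subtype.ext (smul_mul_assoc r x.1 c)))
    1 (fun c x => by
      rw [one_mul, mul_comm]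
      exact norm_mul_le x.1 c)

@[simp] theorem coe_mulRight (c : A) (x : J.toSubmodule) : (J.mulRight c x : A) = x.1 * c :=
  rfl

theorem norm_mulRight_le (c : A) : ‖J.mulRight c‖ ≤ ‖c‖ := by
  refine ContinuousLinearMap.opNorm_le_bound _ (norm_nonneg c) fun x => ?_
  rw [mul_comm]
  exact norm_mul_le x.1 c

/-- Evaluating at `star c`, which must lie in `J`, gives `star c * c`, of norm `‖c‖ ^ 2`. -/
theorem norm_mulRight {c : A} (hc : star c ∈ J.toSubmodule) : ‖J.mulRight c‖ = ‖c‖ := by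
  refine le_antisymm (J.norm_mulRight_le c) ?_
  rcases eq_or_ne c 0 with rfl | h0
  · exact le_of_eq_of_le norm_zero (norm_nonneg (J.mulRight 0))
  have h : ‖c‖ * ‖c‖ ≤ ‖J.mulRight c‖ * ‖c‖ := by
    rw [← CStarRing.norm_star_mul_self]
    simpa using (J.mulRight c).le_opNorm ⟨star c, hc⟩
  exact le_of_mul_le_mul_right h (norm_pos_iff.mpr h0)

/-- The closed linear span of the elements `star y * x` with `x, y ∈ J`. -/
def coefficients : Submodule ℂ A :=
  (Submodule.span ℂ {d : A | ∃ x ∈ J.toSubmodule, ∃ y ∈ J.toSubmodule,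
    d = star y * x}).topologicalClosure

theorem star_mul_mem_coefficients {x y : A} (hx : x ∈ J.toSubmodule) (hy : y ∈ J.toSubmodule) :
    star y * x ∈ J.coefficients :=
  Submodule.le_topologicalClosure _ (Submodule.subset_span ⟨x, hx, y, hy, rfl⟩)

theorem isClosed_coefficients : IsClosed (J.coefficients : Set A) :=
  Submodule.isClosed_topologicalClosure _

variable {J} in
theorem coefficients_le {P : Submodule ℂ A} (hP : IsClosed (P : Set A))
    (h : ∀ x ∈ J.toSubmodule, ∀ y ∈ J.toSubmodule, star y * x ∈ P) : J.coefficients ≤ P := by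
  refine Submodule.topologicalClosure_minimal _ (Submodule.span_le.mpr ?_) hP
  rintro _ ⟨x, hx, y, hy, rfl⟩
  exact h x hx y hy

theorem coefficients_le_toSubmodule : J.coefficients ≤ J.toSubmodule :=
  coefficients_le J.isClosed' fun _ hx y _ => J.mul_mem_left' (star y) hx

/-- Visible on generators, as `star (star y * x) = star x * y`; the general fact that closed ideals
are self-adjoint is not needed. -/
theorem star_mem_of_mem_coefficients {c : A} (hc : c ∈ J.coefficients) :
    star c ∈ J.toSubmodule := by
  have hcl : IsClosed {c : A | star c ∈ J.toSubmodule} := J.isClosed'.preimage continuous_star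
  refine closure_minimal (fun c hc => ?_) hcl hc
  change star c ∈ J.toSubmodule
  induction hc using Submodule.span_induction with
  | mem c hc =>
    obtain ⟨x, -, y, hy, rfl⟩ := hc
    rw [star_mul, star_star]
    exact J.mul_mem_left' _ hy
  | zero => simp
  | add u v _ _ hu hv => simpa using add_mem hu hv
  | smul r u _ hu => simpa using J.toSubmodule.smul_mem (star r) hu

/-- An isometric image of a complete space is closed. Hence the norm closure in the definition of
compact endomorphisms produces nothing but right multiplications. -/
theorem isClosed_map_mulRight :
    IsClosed
      (J.coefficients.map J.mulRight.toLinearMap : Set (J.toSubmodule →L[ℂ] J.toSubmodule)) := by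
  have : CompleteSpace J.coefficients :=
    IsClosed.completeSpace_coe (hs := J.isClosed_coefficients)
  let F : J.coefficients →ₗᵢ[ℂ] (J.toSubmodule →L[ℂ] J.toSubmodule) :=
    { J.mulRight.toLinearMap ∘ₗ J.coefficients.subtype with
      norm_map' := fun c => J.norm_mulRight (J.star_mem_of_mem_coefficients c.2) }
  have h : (J.coefficients.map J.mulRight.toLinearMap : Set _) = Set.range F :=
    Set.image_eq_range _ _
  rw [h]
  exact F.isometry.isUniformInducing.isComplete_range.isClosed

section

variable [PartialOrder A] [StarOrderedRing A]

theorem inner_def (x y : J.toSubmodule) : (inner A x y : A) = y.1 * star x.1 :=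
  rfl

theorem mulRight_star_mul_mem (x y : J.toSubmodule) :
    J.mulRight (star y.1 * x.1) ∈ rankOneEndomorphisms (Y := J.toSubmodule) A :=
  ⟨x, y, fun z => Subtype.ext (mul_assoc z.1 (star y.1) x.1).symm⟩

/-- The compact endomorphisms of a closed ideal are the right multiplications by its
coefficients. -/
theorem compactEndomorphisms_eq :
    compactEndomorphisms (Y := J.toSubmodule) A = J.coefficients.map J.mulRight.toLinearMap := by
  apply le_antisymm
  · refine Submodule.topologicalClosure_minimal _ (Submodule.span_le.mpr ?_) J.isClosed_map_mulRight
    rintro f ⟨x, y, hf⟩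
    refine ⟨star y.1 * x.1, J.star_mul_mem_coefficients x.2 y.2, ?_⟩
    ext z
    rw [hf z]
    exact (mul_assoc z.1 (star y.1) x.1).symm
  · rw [Submodule.map_le_iff_le_comap]
    refine coefficients_le
      ((Submodule.isClosed_topologicalClosure _).preimage J.mulRight.continuous) fun x hx y hy => ?_
    exact Submodule.le_topologicalClosure _
      (Submodule.subset_span (J.mulRight_star_mul_mem ⟨x, hx⟩ ⟨y, hy⟩))

theorem isSelfAdjointEndomorphism_mulRight_iff {c : A} (hc : c ∈ J.coefficients) :
    IsSelfAdjointEndomorphism A (J.mulRight c) ↔ IsSelfAdjoint c := by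
  constructor
  · intro h
    have hc' := J.coefficients_le_toSubmodule hc
    have hcs := J.star_mem_of_mem_coefficients hc
    set e := star c - c with he
    have hes : star e = -e := by simp [he]
    have heJ : e ∈ J.toSubmodule := sub_mem hcs hc'
    -- Self-adjointness of the endomorphism, tested at `x = y = e`, reads `e * star c * star e = e *
    -- c * star e`.
    have h1 : e * e * star e = 0 := by
      have := h ⟨e, heJ⟩ ⟨e, heJ⟩
      simp only [inner_def, coe_mulRight, star_mul, ← mul_assoc] at this
      rw [he, mul_sub, sub_mul, ← he, this, sub_self]
    rw [hes, mul_neg, neg_eq_zero] at h1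
    -- `e` is skew-adjoint with cube zero, so its fourth power vanishes and the C*-identity, used
    -- twice, gives `e = 0`.
    have h2 : star (star e * e) * (star e * e) = 0 := by
      rw [star_mul, star_star, hes, neg_mul, neg_mul_neg, ← mul_assoc, h1, zero_mul]
    have h3 : e = 0 :=
      CStarRing.star_mul_self_eq_zero_iff _ |>.mp (CStarRing.star_mul_self_eq_zero_iff _ |>.mp h2)
    exact sub_eq_zero.mp h3
  · intro h x y
    simp [inner_def, mul_assoc, h.star_eq]

end

theorem compactlyContained_iff (I : ClosedIdeal A) :
    I ⊂⊂ J ↔ I.toSubmodule ≤ J.toSubmodule ∧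
      ∃ c ∈ J.coefficients, IsSelfAdjoint c ∧ ∀ x ∈ I.toSubmodule, x * c = x := by
  let _ := CStarAlgebra.spectralOrder A
  let _ := CStarAlgebra.spectralOrderedRing A
  unfold CompactlyContained CompactlyContainedSubmodule
  refine and_congr_right fun hIJ => ?_
  rw [compactEndomorphisms_eq]
  constructor
  · rintro ⟨_, ⟨c, hc, rfl⟩, hsa, hx⟩
    refine ⟨c, hc, (J.isSelfAdjointEndomorphism_mulRight_iff hc).mp hsa, fun x hxI => ?_⟩
    exact congrArg Subtype.val (hx ⟨x, hIJ hxI⟩ hxI)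
  · rintro ⟨c, hc, hsa, hx⟩
    exact ⟨J.mulRight c, ⟨c, hc, rfl⟩, (J.isSelfAdjointEndomorphism_mulRight_iff hc).mpr hsa,
      fun x hxI => Subtype.ext (hx x.1 hxI)⟩

end ClosedIdeal

/-! ### Separate continuity of the tensor product and compact containment -/

namespace CStarTensorProduct

variable {A B T : Type*} [NonUnitalCStarAlgebra A] [NonUnitalCStarAlgebra B]
  [NonUnitalCStarAlgebra T] (τ : CStarTensorProduct A B T)

theorem hom_mul (a a' : A) (b b' : B) :
    τ.hom (a ⊗ₜ[ℂ] b) * τ.hom (a' ⊗ₜ[ℂ] b') = τ.hom ((a * a') ⊗ₜ[ℂ] (b * b')) := by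
  rw [← map_mul, Algebra.TensorProduct.tmul_mul_tmul]

theorem star_hom (a : A) (b : B) :
    star (τ.hom (a ⊗ₜ[ℂ] b)) = τ.hom (star a ⊗ₜ[ℂ] star b) := by
  rw [← map_star, TensorProduct.star_tmul]

/-- The bilinear map `(a, b) ↦ a ⊗ b` into a C*-tensor product. -/
def bilin : A →ₗ[ℂ] B →ₗ[ℂ] T :=
  LinearMap.mk₂ ℂ (fun a b => τ.hom (a ⊗ₜ[ℂ] b))
    (fun a a' b => by rw [TensorProduct.add_tmul, map_add])
    (fun c a b => by rw [← TensorProduct.smul_tmul', map_smul])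
    (fun a b b' => by rw [TensorProduct.tmul_add, map_add])
    (fun c a b => by rw [TensorProduct.tmul_smul, map_smul])

@[simp] theorem bilin_apply (a : A) (b : B) : τ.bilin a b = τ.hom (a ⊗ₜ[ℂ] b) :=
  rfl

/-- A linear map between C*-algebras mapping the elements `star a * a` to nonnegative elements is
continuous. -/
theorem continuous_of_map_star_mul_self [PartialOrder T] [StarOrderedRing T] (f : A →ₗ[ℂ] T)
    (hf : ∀ a, 0 ≤ f (star a * a)) : Continuous f := by
  let _ := CStarAlgebra.spectralOrder A
  let _ := CStarAlgebra.spectralOrderedRing A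
  have hpos : ∀ a, 0 ≤ a → 0 ≤ f a := by
    intro a ha
    obtain ⟨s, rfl⟩ := CStarAlgebra.nonneg_iff_eq_star_mul_self.mp ha
    exact hf s
  let F : A →ₚ[ℂ] T :=
    { f with monotone' := fun a b hab => by simpa using hpos _ (sub_nonneg.mpr hab) }
  -- Positive linear maps between C*-algebras are automatically continuous.
  exact map_continuous F

/-- By linearity `b` may be taken positive, `b = star t * t`. Then `star a * a ⊗ b = star (a ⊗ t) *
(a ⊗ t)` is positive, so the map is positive. -/
theorem continuous_hom_left (b : B) : Continuous fun a : A => τ.hom (a ⊗ₜ[ℂ] b) := by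
  let _ := CStarAlgebra.spectralOrder B
  let _ := CStarAlgebra.spectralOrderedRing B
  let _ := CStarAlgebra.spectralOrder T
  let _ := CStarAlgebra.spectralOrderedRing T
  have hb : b ∈ Submodule.span ℂ {b : B | 0 ≤ b} := by
    rw [CStarAlgebra.span_nonneg]; trivial
  induction hb using Submodule.span_induction with
  | mem b hb =>
    obtain ⟨t, rfl⟩ := CStarAlgebra.nonneg_iff_eq_star_mul_self.mp (Set.mem_ofPred.mp hb)
    refine continuous_of_map_star_mul_self (τ.bilin.flip (star t * t)) fun a => ?_
    rw [LinearMap.flip_apply, bilin_apply, ← hom_mul, ← star_hom]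
    exact star_mul_self_nonneg _
  | zero => simpa using continuous_const
  | add u v _ _ hu hv => simpa [TensorProduct.tmul_add] using Continuous.fun_add hu hv
  | smul c u _ hu => simpa using Continuous.fun_const_smul hu c

theorem continuous_hom_right (a : A) : Continuous fun b : B => τ.hom (a ⊗ₜ[ℂ] b) := by
  let _ := CStarAlgebra.spectralOrder A
  let _ := CStarAlgebra.spectralOrderedRing A
  let _ := CStarAlgebra.spectralOrder T
  let _ := CStarAlgebra.spectralOrderedRing T
  have ha : a ∈ Submodule.span ℂ {a : A | 0 ≤ a} := by
    rw [CStarAlgebra.span_nonneg]; trivial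
  induction ha using Submodule.span_induction with
  | mem a ha =>
    obtain ⟨s, rfl⟩ := CStarAlgebra.nonneg_iff_eq_star_mul_self.mp (Set.mem_ofPred.mp ha)
    refine continuous_of_map_star_mul_self (τ.bilin (star s * s)) fun b => ?_
    rw [bilin_apply, ← hom_mul, ← star_hom]
    exact star_mul_self_nonneg _
  | zero => simpa using continuous_const
  | add u v _ _ hu hv => simpa [TensorProduct.add_tmul] using Continuous.fun_add hu hv
  | smul c u _ hu =>
    simpa only [← TensorProduct.smul_tmul', map_smul] using Continuous.fun_const_smul hu c

theorem hom_mem_ideal {I : ClosedIdeal A} {J : ClosedIdeal B} {x : A} {y : B}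
    (hx : x ∈ I.toSubmodule) (hy : y ∈ J.toSubmodule) :
    τ.hom (x ⊗ₜ[ℂ] y) ∈ (τ.ideal I J).toSubmodule :=
  (τ.tmul ⟨x, hx⟩ ⟨y, hy⟩).2

theorem ideal_le {I : ClosedIdeal A} {J : ClosedIdeal B} {P : Submodule ℂ T}
    (hP : IsClosed (P : Set T))
    (h : ∀ x ∈ I.toSubmodule, ∀ y ∈ J.toSubmodule, τ.hom (x ⊗ₜ[ℂ] y) ∈ P) :
    (τ.ideal I J).toSubmodule ≤ P := by
  refine Submodule.topologicalClosure_minimal _ (Submodule.span_le.mpr ?_) hP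
  rintro _ ⟨x, hx, y, hy, rfl⟩
  exact h x hx y hy

/-- On generators, `star y * x ⊗ star y' * x' = star (y ⊗ y') * (x ⊗ x')`. The closures are then
handled one variable at a time. -/
theorem hom_mem_coefficients {I : ClosedIdeal A} {J : ClosedIdeal B} {c : A} {d : B}
    (hc : c ∈ I.coefficients) (hd : d ∈ J.coefficients) :
    τ.hom (c ⊗ₜ[ℂ] d) ∈ (τ.ideal I J).coefficients := by
  have hcl := (τ.ideal I J).isClosed_coefficients
  refine ClosedIdeal.coefficients_le
    (P := (τ.ideal I J).coefficients.comap (τ.bilin.flip d))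
    (hcl.preimage (τ.continuous_hom_left d)) (fun x hx y hy => ?_) hc
  refine ClosedIdeal.coefficients_le
    (P := (τ.ideal I J).coefficients.comap (τ.bilin (star y * x)))
    (hcl.preimage (τ.continuous_hom_right _)) (fun x' hx' y' hy' => ?_) hd
  rw [Submodule.mem_comap, bilin_apply, ← hom_mul, ← star_hom]
  exact (τ.ideal I J).star_mul_mem_coefficients (τ.hom_mem_ideal hx hx') (τ.hom_mem_ideal hy hy')

theorem compactlyContained_ideal {I₁ J₁ : ClosedIdeal A} {I₂ J₂ : ClosedIdeal B}
    (h₁ : I₁ ⊂⊂ J₁) (h₂ : I₂ ⊂⊂ J₂) : τ.ideal I₁ I₂ ⊂⊂ τ.ideal J₁ J₂ := by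
  rw [ClosedIdeal.compactlyContained_iff] at *
  obtain ⟨hIJ₁, c, hc, hcs, hcI⟩ := h₁
  obtain ⟨hIJ₂, d, hd, hds, hdI⟩ := h₂
  refine ⟨τ.ideal_le (τ.ideal J₁ J₂).isClosed' fun x hx y hy =>
      τ.hom_mem_ideal (hIJ₁ hx) (hIJ₂ hy),
    τ.hom (c ⊗ₜ[ℂ] d), τ.hom_mem_coefficients hc hd, ?_, ?_⟩
  · rw [isSelfAdjoint_iff, star_hom, hcs.star_eq, hds.star_eq]
  -- The elements fixed by right multiplication by `c ⊗ d` form a closed subspace, so elementary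
  -- tensors suffice.
  · let P : Submodule ℂ T :=
      LinearMap.eqLocus (LinearMap.mulRight ℂ (τ.hom (c ⊗ₜ[ℂ] d))) LinearMap.id
    have hP : IsClosed (P : Set T) :=
      isClosed_eq (f := fun t => t * τ.hom (c ⊗ₜ[ℂ] d)) (g := id) (by fun_prop) continuous_id
    refine fun t ht => τ.ideal_le (P := P) hP (fun x hx y hy => ?_) ht
    change τ.hom (x ⊗ₜ[ℂ] y) * τ.hom (c ⊗ₜ[ℂ] d) = τ.hom (x ⊗ₜ[ℂ] y)
    rw [hom_mul, hcI x hx, hdI y hy]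

end CStarTensorProduct

/-! ### Countable generation -/

/-- A closed ideal is countably generated as a Hilbert C*-module if and only if it is contained in
the closed left ideal generated by a countable subset. -/
theorem ClosedIdeal.countablyGenerated_iff {A : Type*} [NonUnitalCStarAlgebra A]
    (I : ClosedIdeal A) :
    I.CountablyGenerated ↔ ∃ S : Set A, S.Countable ∧ S ⊆ I.toSubmodule ∧
      I.toSubmodule ≤
        (Submodule.span ℂ {z : A | ∃ a : A, ∃ s ∈ S, z = a * s}).topologicalClosure := by
  -- `I` carries the induced topology, so density inside `I` is the same as `I` lying in the closure
  -- taken in `A`.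
  have key : ∀ S : Set I.toSubmodule,
      (Submodule.span ℂ {z : I.toSubmodule | ∃ a : A, ∃ s ∈ S, z = a • s}).topologicalClosure = ⊤ ↔
      I.toSubmodule ≤ (Submodule.span ℂ
        {z : A | ∃ a : A, ∃ s ∈ ((↑) '' S : Set A), z = a * s}).topologicalClosure := by
    intro S
    have himage : {z : A | ∃ a : A, ∃ s ∈ ((↑) '' S : Set A), z = a * s} =
        I.toSubmodule.subtype '' {z : I.toSubmodule | ∃ a : A, ∃ s ∈ S, z = a • s} := by
      ext z
      constructor
      · rintro ⟨a, _, ⟨s, hs, rfl⟩, rfl⟩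
        exact ⟨a • s, ⟨a, s, hs, rfl⟩, rfl⟩
      · rintro ⟨_, ⟨a, s, hs, rfl⟩, rfl⟩
        exact ⟨a, s, ⟨s, hs, rfl⟩, rfl⟩
    rw [himage, ← Submodule.map_span, ← Submodule.dense_iff_topologicalClosure_eq_top,
      dense_iff_closure_eq, Topology.IsInducing.subtypeVal.closure_eq_preimage_closure_image,
      Set.eq_univ_iff_forall]
    exact ⟨fun h x hx => h ⟨x, hx⟩, fun h x => h x.2⟩
  unfold CountablyGenerated CountablyGeneratedModule
  constructor
  · rintro ⟨S, hS, h⟩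
    refine ⟨Subtype.val '' S, hS.image _, ?_, (key S).mp h⟩
    rintro _ ⟨x, -, rfl⟩
    exact x.2
  · rintro ⟨S, hS, hSI, h⟩
    refine ⟨(↑) ⁻¹' S, hS.preimage Subtype.val_injective, (key _).mpr ?_⟩
    have hS' : ((↑) '' ((↑) ⁻¹' S : Set I.toSubmodule) : Set A) = S :=
      Set.image_preimage_eq_of_subset fun s hs => ⟨⟨s, hSI hs⟩, rfl⟩
    rwa [hS']

namespace CStarTensorProduct

variable {A B T : Type*} [NonUnitalCStarAlgebra A] [NonUnitalCStarAlgebra B]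
  [NonUnitalCStarAlgebra T] (τ : CStarTensorProduct A B T)

/-- The tensors `s ⊗ r` of generators generate, because `a * s ⊗ b * r = (a ⊗ b) * (s ⊗ r)`;
separate continuity extends this first to all `x ∈ I`, then to all `y ∈ J`. -/
theorem countablyGenerated_ideal {I : ClosedIdeal A} {J : ClosedIdeal B}
    (hI : I.CountablyGenerated) (hJ : J.CountablyGenerated) :
    (τ.ideal I J).CountablyGenerated := by
  rw [ClosedIdeal.countablyGenerated_iff] at *
  obtain ⟨S, hS, hSI, hI⟩ := hI
  obtain ⟨R, hR, hRJ, hJ⟩ := hJ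
  refine ⟨Set.image2 (fun s r => τ.hom (s ⊗ₜ[ℂ] r)) S R, hS.image2 hR _, ?_, ?_⟩
  · rintro _ ⟨s, hs, r, hr, rfl⟩
    exact τ.hom_mem_ideal (hSI hs) (hRJ hr)
  · set P := (Submodule.span ℂ {z : T | ∃ a : T,
      ∃ s ∈ Set.image2 (fun s r => τ.hom (s ⊗ₜ[ℂ] r)) S R, z = a * s}).topologicalClosure
    have hP : IsClosed (P : Set T) := Submodule.isClosed_topologicalClosure _
    refine τ.ideal_le hP fun x hx y hy => ?_
    refine Submodule.topologicalClosure_minimal _ (t := P.comap (τ.bilin.flip y))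
      (Submodule.span_le.mpr ?_) (hP.preimage (τ.continuous_hom_left y)) (hI hx)
    rintro _ ⟨a, s, hs, rfl⟩
    refine Submodule.topologicalClosure_minimal _ (t := P.comap (τ.bilin (a * s)))
      (Submodule.span_le.mpr ?_) (hP.preimage (τ.continuous_hom_right _)) (hJ hy)
    rintro _ ⟨b, r, hr, rfl⟩
    exact Submodule.le_topologicalClosure _ (Submodule.subset_span
      ⟨τ.hom (a ⊗ₜ[ℂ] b), _, ⟨s, hs, r, hr, rfl⟩, (τ.hom_mul a s b r).symm⟩)

end CStarTensorProduct

end HilbertIdeal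

open HilbertIdeal in
theorem corollary4p2 {A : Type*} [NonUnitalCStarAlgebra A] (I₁ I₂ J₁ J₂ : ClosedIdeal A)
    (h₁ : I₁ ⊂⊂ J₁) (h₂ : I₂ ⊂⊂ J₂) :
    -- the spatial tensor product, formed in any two faithful representations
    (∀ (H K : Type*) [NormedAddCommGroup H] [InnerProductSpace ℂ H] [CompleteSpace H]
        [NormedAddCommGroup K] [InnerProductSpace ℂ K] [CompleteSpace K]
        (π : A →⋆ₙₐ[ℂ] (H →L[ℂ] H)) (ρ : A →⋆ₙₐ[ℂ] (K →L[ℂ] K))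
        (hπ : Function.Injective π) (hρ : Function.Injective ρ),
        ((spatialTensorProduct π ρ hπ hρ).ideal I₁ I₂ ⊂⊂
          (spatialTensorProduct π ρ hπ hρ).ideal J₁ J₂) ∧
        (I₁.CountablyGenerated → I₂.CountablyGenerated →
          ((spatialTensorProduct π ρ hπ hρ).ideal I₁ I₂).CountablyGenerated) ∧
        (J₁.CountablyGenerated → J₂.CountablyGenerated →
          ((spatialTensorProduct π ρ hπ hρ).ideal J₁ J₂).CountablyGenerated)) ∧
    -- any other C*-tensor product (maximal, intermediate)
    (∀ (T : Type*) [NonUnitalCStarAlgebra T] (τ : CStarTensorProduct A A T),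
        (τ.ideal I₁ I₂ ⊂⊂ τ.ideal J₁ J₂) ∧
        (I₁.CountablyGenerated → I₂.CountablyGenerated →
          (τ.ideal I₁ I₂).CountablyGenerated) ∧
        (J₁.CountablyGenerated → J₂.CountablyGenerated →
          (τ.ideal J₁ J₂).CountablyGenerated)) := by
  -- The spatial case is an instance of the statement for an arbitrary `CStarTensorProduct`.
  exact ⟨fun _ _ _ _ _ _ _ _ _ _ _ _ =>
      ⟨CStarTensorProduct.compactlyContained_ideal _ h₁ h₂,
        CStarTensorProduct.countablyGenerated_ideal _,
        CStarTensorProduct.countablyGenerated_ideal _⟩,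
    fun _ _ τ => ⟨τ.compactlyContained_ideal h₁ h₂, τ.countablyGenerated_ideal,
      τ.countablyGenerated_ideal⟩⟩
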